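/- **Proposition 4 (Weyl divergence for marginally naked singularity).** Use units with $8\pi G=c=1$. Let $ds^2=-A^2dt^2+B^2dr^2+R^2(d\vartheta^2+\sin^2\vartheta\,d\varphi^2)$, with positive $C^2$ functions $A,B,R$ of $(t,r)$ on an open set $D$ of the half-plane $r>0$, be a spherically symmetric spacetime satisfying Einstein's equations $G_{ab}=\mu u_au_b+p(g_{ab}+u_au_b)$ for a perfect fluid comoving with $u=A^{-1}\partial_t$, where $r$ labels the spherical shells and the centre is $r=0$. Put $e=B^{-1}\partial_r$ and let $\mathcal E=C_{acbd}u^cu^de^ae^b$ be the electric Weyl scalar. Assume the strong energy conditions $\mu\ge 0$ and $\mu+3p\ge 0$. Suppose that the collapse forms a central singularity $(t_s,0)$: from some time $t_i<t_s$ up to $t_s$ the centre is a worldline of finite proper length near which the fluid is present, the curvature (Kretschmann scalar) is bounded and $R\to0$, while on approach to $(t_s,0)$ one has $R\to 0$ and the curvature is unbounded. Let the apparent horizon, i.e. the curve in the $(t,r)$ plane on which the expansion $N^{ab}\nabla_ak_b$ of the outgoing null vector $k=(u+e)/\sqrt2$ vanishes ($N^{ab}=g^{ab}+u^au^b-e^ae^b$),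 be given by a differentiable curve $\gamma(s)$, $s>0$ small, with $\gamma(s)\to(t_s,0)$ as $s\to0^+$ and tangent $\gamma'=\alpha u+\beta e$; assume that the fluid is not vacuum on $\gamma$ near the singularity ($\mu+p\neq 0$ there). If 1. the spacetime is free of shell crossings ($\partial R/\partial r>0$), 2. closed trapped surfaces exist (on some sphere of constant $(t,r)$ the expansions of $(u+e)/\sqrt2$ and $(u-e)/\sqrt2$ are both negative), 3. the central singularity is marginally naked, i.e. $\alpha/\beta\to1$ along the apparent horizon as $s\to0^+$, then $\dfrac{|\mathcal E|}{\mu+p}\to+\infty$ along the apparent horizon curve as it approaches the central singularity. -/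

import Mathlib

open Filter Topology Set

noncomputable section

namespace SphericalCollapse

/-! ### Tensor calculus of a metric in a coordinate chart of a four-dimensional spacetime -/

/-- Points of the chart, `x = (t, r, θ, ϕ)`. -/
abbrev Pt := Fin 4 → ℝ

/-- The coordinate partial derivative `∂_i f`. -/
def pd (i : Fin 4) (f : Pt → ℝ) (x : Pt) : ℝ :=
  deriv (fun s => f (Function.update x i s)) (x i)

/-- A field of `4 × 4` matrices `g_{ab}`. -/
abbrev MetricField := Pt → Matrix (Fin 4) (Fin 4) ℝ

/-- Christoffel symbols `Γ^a_{bc}` of the Levi-Civita connection. -/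
def christoffel (g : MetricField) (a b c : Fin 4) (x : Pt) : ℝ :=
  (1 / 2) * ∑ d, (g x)⁻¹ a d *
    (pd b (fun y => g y d c) x + pd c (fun y => g y d b) x - pd d (fun y => g y b c) x)

/-- Riemann tensor
`R^a_{bcd} = ∂_c Γ^a_{db} - ∂_d Γ^a_{cb} + Γ^a_{ce} Γ^e_{db} - Γ^a_{de} Γ^e_{cb}`. -/
def riemann (g : MetricField) (a b c d : Fin 4) (x : Pt) : ℝ :=
  pd c (christoffel g a d b) x - pd d (christoffel g a c b) x
    + ∑ e, (christoffel g a c e x * christoffel g e d b x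
      - christoffel g a d e x * christoffel g e c b x)

/-- Riemann tensor with all indices down, `R_{abcd}`. -/
def riemannLow (g : MetricField) (a b c d : Fin 4) (x : Pt) : ℝ :=
  ∑ e, g x a e * riemann g e b c d x

/-- Ricci tensor `R_{bd} = R^a_{bad}`. -/
def ricci (g : MetricField) (b d : Fin 4) (x : Pt) : ℝ :=
  ∑ a, riemann g a b a d x

/-- Scalar curvature. -/
def scalarCurvature (g : MetricField) (x : Pt) : ℝ :=
  ∑ a, ∑ b, (g x)⁻¹ a b * ricci g a b x

/-- Einstein tensor `G_{ab} = R_{ab} - ½ R g_{ab}`. -/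
def einstein (g : MetricField) (a b : Fin 4) (x : Pt) : ℝ :=
  ricci g a b x - (1 / 2) * scalarCurvature g x * g x a b

/-- Weyl tensor `C_{abcd}` in dimension four. -/
def weyl (g : MetricField) (a b c d : Fin 4) (x : Pt) : ℝ :=
  riemannLow g a b c d x
    - (1 / 2) * (g x a c * ricci g b d x - g x a d * ricci g b c x
        - g x b c * ricci g a d x + g x b d * ricci g a c x)
    + (1 / 6) * scalarCurvature g x * (g x a c * g x b d - g x a d * g x b c)

/-- Kretschmann scalar `R_{abcd} R^{abcd}`. -/
def kretschmann (g : MetricField) (x : Pt) : ℝ :=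
  ∑ a, ∑ b, ∑ c, ∑ d, ∑ a', ∑ b', ∑ c', ∑ d',
    (g x)⁻¹ a a' * (g x)⁻¹ b b' * (g x)⁻¹ c c' * (g x)⁻¹ d d' *
      riemannLow g a b c d x * riemannLow g a' b' c' d' x

/-- Lowering the index of a vector field: `v_a = g_{ab} v^b`. -/
def lower (g : MetricField) (v : Pt → Pt) (a : Fin 4) (x : Pt) : ℝ :=
  ∑ b, g x a b * v x b

/-- Covariant derivative `∇_a v_b = ∂_a v_b - Γ^c_{ab} v_c`. -/
def nabla (g : MetricField) (v : Pt → Pt) (a b : Fin 4) (x : Pt) : ℝ :=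
  pd a (lower g v b) x - ∑ c, christoffel g c a b x * lower g v c x

/-- Electric Weyl scalar relative to a timelike unit field `u` and a spacelike unit field `e`:
`ℰ = E_{ab} e^a e^b`, where `E_{ab} = C_{acbd} u^c u^d` is the electric part of the Weyl tensor. -/
def electricWeyl (g : MetricField) (u e : Pt → Pt) (x : Pt) : ℝ :=
  ∑ a, ∑ b, ∑ c, ∑ d, weyl g a c b d x * e x a * u x c * e x b * u x d

/-- Expansion `N^{ab} ∇_a k_b` of a field `k`, where `N^{ab} = g^{ab} + u^a u^b - e^a e^b`
projects onto the 2-sheets orthogonal to `u` and `e`. -/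
def sheetExpansion (g : MetricField) (u e k : Pt → Pt) (x : Pt) : ℝ :=
  ∑ a, ∑ b, ((g x)⁻¹ a b + u x a * u x b - e x a * e x b) * nabla g k a b x

/-! ### Spherically symmetric perfect fluids in comoving coordinates -/

/-- The data of a spherically symmetric fluid cloud in comoving coordinates `(t, r, θ, ϕ)`:
the metric is `-A² dt² + B² dr² + R² (dθ² + sin² θ dϕ²)` over an open set `D` of the `(t, r)`
half-plane `r > 0`; `r` labels the spherical shells, and the centre is at `r = 0`. -/
structure Cloud where
  /-- the region of the `(t, r)` plane that the cloud occupies, centre excluded -/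
  D : Set (ℝ × ℝ)
  /-- lapse -/
  A : ℝ → ℝ → ℝ
  /-- radial coefficient -/
  B : ℝ → ℝ → ℝ
  /-- area radius of the 2-sheets -/
  R : ℝ → ℝ → ℝ
  /-- energy density -/
  mu : ℝ → ℝ → ℝ
  /-- isotropic pressure -/
  p : ℝ → ℝ → ℝ
  isOpen_D : IsOpen D
  radius_pos : ∀ q ∈ D, 0 < q.2
  A_smooth : ContDiffOn ℝ 2 (fun q : ℝ × ℝ => A q.1 q.2) D
  B_smooth : ContDiffOn ℝ 2 (fun q : ℝ × ℝ => B q.1 q.2) D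
  R_smooth : ContDiffOn ℝ 2 (fun q : ℝ × ℝ => R q.1 q.2) D
  A_pos : ∀ q ∈ D, 0 < A q.1 q.2
  B_pos : ∀ q ∈ D, 0 < B q.1 q.2
  R_pos : ∀ q ∈ D, 0 < R q.1 q.2

namespace Cloud

variable (C : Cloud)

/-- The spacetime metric. -/
def metric : MetricField := fun x =>
  Matrix.diagonal ![-(C.A (x 0) (x 1)) ^ 2, (C.B (x 0) (x 1)) ^ 2, (C.R (x 0) (x 1)) ^ 2,
    (C.R (x 0) (x 1)) ^ 2 * (Real.sin (x 2)) ^ 2]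

/-- The four-velocity of the fluid, `u = A⁻¹ ∂_t`. -/
def u : Pt → Pt := fun x => ![1 / C.A (x 0) (x 1), 0, 0, 0]

/-- The preferred outward radial direction, `e = B⁻¹ ∂_r`. -/
def e : Pt → Pt := fun x => ![0, 1 / C.B (x 0) (x 1), 0, 0]

/-- The outgoing null direction `k = (u + e) / √2`. -/
def outNull : Pt → Pt := fun x => (1 / √2) • (C.u x + C.e x)

/-- The ingoing null direction `l = (u - e) / √2`. -/
def inNull : Pt → Pt := fun x => (1 / √2) • (C.u x - C.e x)

/-- Representative point (on the equator) of the 2-sheet labelled by `(t, r)`.  The scalars below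
are constant on each 2-sheet. -/
def sheetPt (q : ℝ × ℝ) : Pt := ![q.1, q.2, Real.pi / 2, 0]

/-- Expansion of the outgoing null congruence at the 2-sheet `(t, r)`. -/
def thetaOut (q : ℝ × ℝ) : ℝ := sheetExpansion C.metric C.u C.e C.outNull (sheetPt q)

/-- Expansion of the ingoing null congruence at the 2-sheet `(t, r)`. -/
def thetaIn (q : ℝ × ℝ) : ℝ := sheetExpansion C.metric C.u C.e C.inNull (sheetPt q)

/-- The electric Weyl scalar at the 2-sheet `(t, r)`. -/
def weylE (q : ℝ × ℝ) : ℝ := electricWeyl C.metric C.u C.e (sheetPt q)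

/-- The Kretschmann scalar at the 2-sheet `(t, r)`. -/
def kretsch (q : ℝ × ℝ) : ℝ := kretschmann C.metric (sheetPt q)

/-- Einstein's equations `G_{ab} = T_{ab}` (units with `8πG = c = 1`) for the perfect fluid
`T_{ab} = μ u_a u_b + p h_{ab}`, `h_{ab} = g_{ab} + u_a u_b`. -/
def SolvesEinstein : Prop :=
  ∀ x : Pt, (x 0, x 1) ∈ C.D → x 2 ∈ Ioo 0 Real.pi → ∀ a b : Fin 4,
    einstein C.metric a b x =
      C.mu (x 0) (x 1) * (lower C.metric C.u a x * lower C.metric C.u b x)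
        + C.p (x 0) (x 1) *
          (C.metric x a b + lower C.metric C.u a x * lower C.metric C.u b x)

/-- Strong energy conditions. -/
def StrongEnergy : Prop :=
  ∀ q ∈ C.D, 0 ≤ C.mu q.1 q.2 ∧ 0 ≤ C.mu q.1 q.2 + 3 * C.p q.1 q.2

/-- No shell crossings: at each time the area radius strictly increases with the shell label,
`∂R/∂r > 0`. -/
def NoShellCrossing : Prop :=
  ∀ q ∈ C.D, 0 < deriv (fun r => C.R q.1 r) q.2

/-- Closed trapped surfaces exist: on some 2-sheet both null expansions are negative. -/
def HasTrappedSurface : Prop :=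
  ∃ q ∈ C.D, C.thetaOut q < 0 ∧ C.thetaIn q < 0

/-- The collapse starts at a regular epoch and ends at the centre in the curvature singularity
`(t, r) = (ts, 0)`.  From some time `ti` on and up to `ts`, the centre is a worldline of finite
proper length near which the cloud is present and has bounded curvature and area radius tending
to `0`; on approach to `(ts, 0)` the area radius tends to `0` and the curvature is unbounded. -/
structure IsCentralSingularity (ts : ℝ) : Prop where
  regular_before : ∃ ti < ts,
    (∀ t ∈ Ico ti ts,
      (∀ᶠ q in 𝓝[{q : ℝ × ℝ | 0 < q.2}] (t, (0 : ℝ)), q ∈ C.D) ∧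
      (∃ M : ℝ, ∀ᶠ q in 𝓝[C.D] (t, (0 : ℝ)), |C.kretsch q| ≤ M) ∧
      Tendsto (fun q : ℝ × ℝ => C.R q.1 q.2) (𝓝[C.D] (t, (0 : ℝ))) (𝓝 0)) ∧
    ∃ a : ℝ → ℝ, MeasureTheory.IntegrableOn a (Ico ti ts) ∧
      ∀ t ∈ Ico ti ts, 0 < a t ∧
        Tendsto (fun q : ℝ × ℝ => C.A q.1 q.2) (𝓝[C.D] (t, (0 : ℝ))) (𝓝 (a t))
  radius_tendsto : Tendsto (fun q : ℝ × ℝ => C.R q.1 q.2) (𝓝[C.D] (ts, (0 : ℝ))) (𝓝 0)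
  curvature_unbounded : ∀ M : ℝ, ∃ᶠ q in 𝓝[C.D] (ts, (0 : ℝ)), M < |C.kretsch q|

/-- `γ` parametrizes, for small `s > 0`, the apparent horizon (vanishing expansion of the outgoing
null congruence) and reaches the central singularity `(ts, 0)` as `s → 0⁺`; its tangent is
`α u + β e`. -/
structure IsHorizonCurve (ts : ℝ) (γ : ℝ → ℝ × ℝ) (α β : ℝ → ℝ) : Prop where
  mem : ∀ᶠ s in 𝓝[>] (0 : ℝ), γ s ∈ C.D
  horizon : ∀ᶠ s in 𝓝[>] (0 : ℝ), C.thetaOut (γ s) = 0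
  tangent : ∀ᶠ s in 𝓝[>] (0 : ℝ), HasDerivAt γ
    (α s / C.A (γ s).1 (γ s).2, β s / C.B (γ s).1 (γ s).2) s
  limit : Tendsto γ (𝓝[>] 0) (𝓝 (ts, 0))

end Cloud

/-- Marginal nakedness: the slope `α / β` of the tangent `α u + β e` to the apparent horizon
equals `1` at the central singularity, which is reached as `s → 0⁺`. -/
def MarginallyNaked (α β : ℝ → ℝ) : Prop :=
  Tendsto (fun s => α s / β s) (𝓝[>] 0) (𝓝 1)

end SphericalCollapse

end

/-! On the apparent horizon everything reduces to the dimensionless quantities `x = μR²` and `y =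
pR²`. Three facts carry the proof.

The field equations express the electric Weyl scalar as `ℰ = μ/3 - 2m/R³`, with `m` the Misner-Sharp
mass (`weylE_eq`). The outgoing expansion is a positive multiple of `u(R) + e(R)` (`thetaOut_eq`),
so on the horizon `u(R)² = e(R)²`, hence `2m = R` and `ℰ = (x/3 - 1)/R²`.

Differentiating `u(R) + e(R) = 0` along the curve, and using the field equations again, gives `α(1 +
y) = β(1 - x)` (`horizon_slope`).

With `w = α/β` the slope relation reads `x + y = (1 - w)(1 + y)`. As `w → 1`, the energy conditions
`x ≥ 0` and `x + 3y ≥ 0` rule out cancellation or unbounded `y`, so `x` and `x + y` both tend to `0`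
(`density_small_of_slope`). Therefore `|ℰ|/(μ + p) = |x/3 - 1|/(x + y)` diverges. Most of the file
computes the curvature of the diagonal metric from its Christoffel symbols. -/

noncomputable section

namespace SphericalCollapse

/-! ### Partial derivatives of functions of `(t, r)` -/

/-- The partial derivative in the first variable. -/
def dt (F : ℝ → ℝ → ℝ) (t r : ℝ) : ℝ := deriv (fun s => F s r) t

/-- The partial derivative in the second variable. -/
def dr (F : ℝ → ℝ → ℝ) (t r : ℝ) : ℝ := deriv (fun s => F t s) r

section Partials

variable {F : ℝ → ℝ → ℝ} {D : Set (ℝ × ℝ)} {q : ℝ × ℝ}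

lemma hasDerivAt_dt (h : DifferentiableAt ℝ (fun q : ℝ × ℝ => F q.1 q.2) q) :
    HasDerivAt (fun s => F s q.2) (dt F q.1 q.2) q.1 := by
  have h2 : DifferentiableAt ℝ (fun s => F s q.2) q.1 :=
    DifferentiableAt.comp q.1 (f := fun s : ℝ => (s, q.2)) h (by fun_prop)
  exact h2.hasDerivAt

lemma hasDerivAt_dr (h : DifferentiableAt ℝ (fun q : ℝ × ℝ => F q.1 q.2) q) :
    HasDerivAt (fun s => F q.1 s) (dr F q.1 q.2) q.2 := by
  have h2 : DifferentiableAt ℝ (fun s => F q.1 s) q.2 :=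
    DifferentiableAt.comp q.2 (f := fun s : ℝ => (q.1, s)) h (by fun_prop)
  exact h2.hasDerivAt

lemma dt_eq_fderiv (h : DifferentiableAt ℝ (fun q : ℝ × ℝ => F q.1 q.2) q) :
    dt F q.1 q.2 = fderiv ℝ (fun q : ℝ × ℝ => F q.1 q.2) q (1, 0) := by
  have h1 : HasDerivAt (fun s : ℝ => (s, q.2)) ((1 : ℝ), (0 : ℝ)) q.1 :=
    (hasDerivAt_id q.1).prodMk (hasDerivAt_const _ _)
  exact (HasFDerivAt.comp_hasDerivAt (l := fun q : ℝ × ℝ => F q.1 q.2) q.1 h.hasFDerivAt h1).deriv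

lemma dr_eq_fderiv (h : DifferentiableAt ℝ (fun q : ℝ × ℝ => F q.1 q.2) q) :
    dr F q.1 q.2 = fderiv ℝ (fun q : ℝ × ℝ => F q.1 q.2) q (0, 1) := by
  have h1 : HasDerivAt (fun s : ℝ => (q.1, s)) ((0 : ℝ), (1 : ℝ)) q.2 :=
    (hasDerivAt_const _ _).prodMk (hasDerivAt_id q.2)
  exact (HasFDerivAt.comp_hasDerivAt (l := fun q : ℝ × ℝ => F q.1 q.2) q.2 h.hasFDerivAt h1).deriv

/-- The chain rule along a curve in the `(t, r)` plane. -/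
lemma hasDerivAt_comp_curve {γ : ℝ → ℝ × ℝ} {v w s : ℝ}
    (h : DifferentiableAt ℝ (fun q : ℝ × ℝ => F q.1 q.2) (γ s)) (hγ : HasDerivAt γ (v, w) s) :
    HasDerivAt (fun s => F (γ s).1 (γ s).2)
      (v * dt F (γ s).1 (γ s).2 + w * dr F (γ s).1 (γ s).2) s := by
  have h1 := HasFDerivAt.comp_hasDerivAt (l := fun q : ℝ × ℝ => F q.1 q.2) s h.hasFDerivAt hγ
  refine h1.congr_deriv ?_
  rw [dt_eq_fderiv h, dr_eq_fderiv h]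
  have h2 : ((v, w) : ℝ × ℝ) = v • ((1 : ℝ), (0 : ℝ)) + w • ((0 : ℝ), (1 : ℝ)) := by simp
  rw [h2, map_add, map_smul, map_smul, smul_eq_mul, smul_eq_mul]

lemma differentiableAt_of_contDiffOn {n : WithTop ℕ∞} (hD : IsOpen D) (hn : n ≠ 0)
    (hF : ContDiffOn ℝ n (fun q : ℝ × ℝ => F q.1 q.2) D) (hq : q ∈ D) :
    DifferentiableAt ℝ (fun q : ℝ × ℝ => F q.1 q.2) q :=
  (hF.contDiffAt (hD.mem_nhds hq)).differentiableAt hn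

lemma contDiffOn_dt (hD : IsOpen D) (hF : ContDiffOn ℝ 2 (fun q : ℝ × ℝ => F q.1 q.2) D) :
    ContDiffOn ℝ 1 (fun q : ℝ × ℝ => dt F q.1 q.2) D := by
  have h := (hF.fderiv_of_isOpen hD (m := 1) (by norm_num)).clm_apply
    (contDiffOn_const (c := ((1 : ℝ), (0 : ℝ))))
  exact h.congr fun q hq => dt_eq_fderiv (differentiableAt_of_contDiffOn hD two_ne_zero hF hq)

lemma contDiffOn_dr (hD : IsOpen D) (hF : ContDiffOn ℝ 2 (fun q : ℝ × ℝ => F q.1 q.2) D) :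
    ContDiffOn ℝ 1 (fun q : ℝ × ℝ => dr F q.1 q.2) D := by
  have h := (hF.fderiv_of_isOpen hD (m := 1) (by norm_num)).clm_apply
    (contDiffOn_const (c := ((0 : ℝ), (1 : ℝ))))
  exact h.congr fun q hq => dr_eq_fderiv (differentiableAt_of_contDiffOn hD two_ne_zero hF hq)

/-- Mixed second partial derivatives of a `C²` function agree. -/
lemma dt_dr_comm (hD : IsOpen D) (hF : ContDiffOn ℝ 2 (fun q : ℝ × ℝ => F q.1 q.2) D)
    (hq : q ∈ D) : dt (dr F) q.1 q.2 = dr (dt F) q.1 q.2 := by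
  have hs := (hF.contDiffAt (hD.mem_nhds hq)).isSymmSndFDerivAt (by simp)
  have hd : DifferentiableAt ℝ (fderiv ℝ (fun q : ℝ × ℝ => F q.1 q.2)) q :=
    ((hF.fderiv_of_isOpen hD (m := 1) (by norm_num)).contDiffAt (hD.mem_nhds hq)).differentiableAt
      one_ne_zero
  have hev : ∀ᶠ q' in 𝓝 q, q' ∈ D := hD.mem_nhds hq
  have e1 : (fun q : ℝ × ℝ => dr F q.1 q.2) =ᶠ[𝓝 q]
      fun q' => fderiv ℝ (fun q : ℝ × ℝ => F q.1 q.2) q' (0, 1) :=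
    hev.mono fun q' hq' => dr_eq_fderiv (differentiableAt_of_contDiffOn hD two_ne_zero hF hq')
  have e2 : (fun q : ℝ × ℝ => dt F q.1 q.2) =ᶠ[𝓝 q]
      fun q' => fderiv ℝ (fun q : ℝ × ℝ => F q.1 q.2) q' (1, 0) :=
    hev.mono fun q' hq' => dt_eq_fderiv (differentiableAt_of_contDiffOn hD two_ne_zero hF hq')
  rw [dt_eq_fderiv (differentiableAt_of_contDiffOn hD one_ne_zero (contDiffOn_dr hD hF) hq),
    dr_eq_fderiv (differentiableAt_of_contDiffOn hD one_ne_zero (contDiffOn_dt hD hF) hq),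
    e1.fderiv_eq, e2.fderiv_eq, fderiv_clm_apply hd (differentiableAt_const _),
    fderiv_clm_apply hd (differentiableAt_const _)]
  simpa using hs (1, 0) (0, 1)

end Partials

/-! ### Quotient rules in one variable -/

section QuotientRules

variable {f g h : ℝ → ℝ} {f' g' h' s : ℝ}

lemma hasDerivAt_quotient (hf : HasDerivAt f f' s) (hg : HasDerivAt g g' s) (h0 : g s ≠ 0) :
    HasDerivAt (fun s => f s / g s) (f' / g s - f s * g' / g s ^ 2) s := by
  refine (hf.fun_div hg h0).congr_deriv ?_
  field_simp

lemma hasDerivAt_mul_div_sq (hf : HasDerivAt f f' s) (hg : HasDerivAt g g' s)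
    (hh : HasDerivAt h h' s) (h0 : h s ≠ 0) :
    HasDerivAt (fun s => f s * g s / h s ^ 2)
      ((f' * g s + f s * g') / h s ^ 2 - 2 * f s * g s * h' / h s ^ 3) s := by
  refine ((hf.fun_mul hg).fun_div (hh.fun_pow 2) (pow_ne_zero 2 h0)).congr_deriv ?_
  field_simp
  ring

end QuotientRules

/-! ### Coordinate derivatives in the chart -/

lemma pd_congr {f g : Pt → ℝ} {x : Pt} (i : Fin 4) (h : f =ᶠ[𝓝 x] g) : pd i f x = pd i g x := by
  have hc : Tendsto (fun s => Function.update x i s) (𝓝 (x i)) (𝓝 x) := by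
    have : Continuous fun s => Function.update x i s := by fun_prop
    simpa using this.tendsto (x i)
  exact Filter.EventuallyEq.deriv_eq (hc.eventually h)

section Separable

variable {F : ℝ → ℝ → ℝ} {a : ℝ → ℝ} {x : Pt}

/-- Metric entries and Christoffel symbols are all of the form `F(t, r) a(θ)`, so these four rules
cover every coordinate derivative needed. -/
lemma pd_zero_separable (h : DifferentiableAt ℝ (fun q : ℝ × ℝ => F q.1 q.2) (x 0, x 1)) :
    pd 0 (fun y => F (y 0) (y 1) * a (y 2)) x = dt F (x 0) (x 1) * a (x 2) := by
  simpa [pd, Function.update] using ((hasDerivAt_dt h).mul_const (a (x 2))).deriv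

lemma pd_one_separable (h : DifferentiableAt ℝ (fun q : ℝ × ℝ => F q.1 q.2) (x 0, x 1)) :
    pd 1 (fun y => F (y 0) (y 1) * a (y 2)) x = dr F (x 0) (x 1) * a (x 2) := by
  simpa [pd, Function.update] using ((hasDerivAt_dr h).mul_const (a (x 2))).deriv

lemma pd_two_separable :
    pd 2 (fun y => F (y 0) (y 1) * a (y 2)) x = F (x 0) (x 1) * deriv a (x 2) := by
  simp [pd, Function.update]

lemma pd_three_separable : pd 3 (fun y => F (y 0) (y 1) * a (y 2)) x = 0 := by
  simp [pd, Function.update]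

end Separable

/-! ### The Levi-Civita connection of the comoving metric -/

namespace Cloud

variable (C : Cloud)

lemma A_ne {q : ℝ × ℝ} (hq : q ∈ C.D) : C.A q.1 q.2 ≠ 0 := (C.A_pos q hq).ne'
lemma B_ne {q : ℝ × ℝ} (hq : q ∈ C.D) : C.B q.1 q.2 ≠ 0 := (C.B_pos q hq).ne'
lemma R_ne {q : ℝ × ℝ} (hq : q ∈ C.D) : C.R q.1 q.2 ≠ 0 := (C.R_pos q hq).ne'

/-- The part of the Christoffel symbols that depends on `(t, r)`. -/
def christoffelRadial : Fin 4 → Fin 4 → Fin 4 → ℝ → ℝ → ℝ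
  | 0, 0, 0 => fun t r => dt C.A t r / C.A t r
  | 0, 0, 1 => fun t r => dr C.A t r / C.A t r
  | 0, 1, 0 => fun t r => dr C.A t r / C.A t r
  | 0, 1, 1 => fun t r => C.B t r * dt C.B t r / C.A t r ^ 2
  | 0, 2, 2 => fun t r => C.R t r * dt C.R t r / C.A t r ^ 2
  | 0, 3, 3 => fun t r => C.R t r * dt C.R t r / C.A t r ^ 2
  | 1, 0, 0 => fun t r => C.A t r * dr C.A t r / C.B t r ^ 2
  | 1, 0, 1 => fun t r => dt C.B t r / C.B t r
  | 1, 1, 0 => fun t r => dt C.B t r / C.B t r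
  | 1, 1, 1 => fun t r => dr C.B t r / C.B t r
  | 1, 2, 2 => fun t r => C.R t r * dr C.R t r / C.B t r ^ 2
  | 1, 3, 3 => fun t r => C.R t r * dr C.R t r / C.B t r ^ 2
  | 2, 0, 2 => fun t r => dt C.R t r / C.R t r
  | 2, 2, 0 => fun t r => dt C.R t r / C.R t r
  | 2, 1, 2 => fun t r => dr C.R t r / C.R t r
  | 2, 2, 1 => fun t r => dr C.R t r / C.R t r
  | 2, 3, 3 => fun _ _ => 1
  | 3, 0, 3 => fun t r => dt C.R t r / C.R t r
  | 3, 3, 0 => fun t r => dt C.R t r / C.R t r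
  | 3, 1, 3 => fun t r => dr C.R t r / C.R t r
  | 3, 3, 1 => fun t r => dr C.R t r / C.R t r
  | 3, 2, 3 => fun _ _ => 1
  | 3, 3, 2 => fun _ _ => 1
  | _, _, _ => fun _ _ => 0

/-- The part of the Christoffel symbols that depends on `θ`. -/
def christoffelAngular : Fin 4 → Fin 4 → Fin 4 → ℝ → ℝ
  | 0, 3, 3 => fun θ => Real.sin θ ^ 2
  | 1, 2, 2 => fun _ => -1
  | 1, 3, 3 => fun θ => -Real.sin θ ^ 2
  | 2, 3, 3 => fun θ => -(Real.sin θ * Real.cos θ)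
  | 3, 2, 3 => fun θ => Real.cos θ / Real.sin θ
  | 3, 3, 2 => fun θ => Real.cos θ / Real.sin θ
  | _, _, _ => fun _ => 1

/-- The diagonal entry `g_{aa}` as a function of `(t, r)`, up to the factor `sin² θ` for `a = 3`. -/
def metricRadial : Fin 4 → ℝ → ℝ → ℝ
  | 0 => fun t r => -C.A t r ^ 2
  | 1 => fun t r => C.B t r ^ 2
  | 2 => fun t r => C.R t r ^ 2
  | 3 => fun t r => C.R t r ^ 2

/-- The factor of `g_{aa}` that depends on `θ`. -/
def metricAngular : Fin 4 → ℝ → ℝ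
  | 3 => fun θ => Real.sin θ ^ 2
  | _ => fun _ => 1

lemma metric_apply (x : Pt) (a b : Fin 4) :
    C.metric x a b = if a = b then C.metricRadial a (x 0) (x 1) * metricAngular a (x 2) else 0 := by
  fin_cases a <;> fin_cases b <;> simp [metric, metricRadial, metricAngular]

lemma metric_inv_apply {x : Pt} (hx : (x 0, x 1) ∈ C.D) (hs : Real.sin (x 2) ≠ 0) (a b : Fin 4) :
    (C.metric x)⁻¹ a b =
      if a = b then (C.metricRadial a (x 0) (x 1) * metricAngular a (x 2))⁻¹ else 0 := by
  have hA := C.A_ne hx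
  have hB := C.B_ne hx
  have hR := C.R_ne hx
  have h : (C.metric x)⁻¹ =
      Matrix.diagonal fun a => (C.metricRadial a (x 0) (x 1) * metricAngular a (x 2))⁻¹ := by
    apply Matrix.inv_eq_right_inv
    have hm : C.metric x =
        Matrix.diagonal fun a => C.metricRadial a (x 0) (x 1) * metricAngular a (x 2) := by
      ext a b
      rw [metric_apply, Matrix.diagonal_apply]
    rw [hm, Matrix.diagonal_mul_diagonal, ← Matrix.diagonal_one]
    congr 1
    ext a
    apply mul_inv_cancel₀
    fin_cases a <;> simp_all [metricRadial, metricAngular]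
  rw [h, Matrix.diagonal_apply]

lemma differentiableAt_A {q : ℝ × ℝ} (hq : q ∈ C.D) :
    DifferentiableAt ℝ (fun q : ℝ × ℝ => C.A q.1 q.2) q :=
  differentiableAt_of_contDiffOn C.isOpen_D two_ne_zero C.A_smooth hq

lemma differentiableAt_B {q : ℝ × ℝ} (hq : q ∈ C.D) :
    DifferentiableAt ℝ (fun q : ℝ × ℝ => C.B q.1 q.2) q :=
  differentiableAt_of_contDiffOn C.isOpen_D two_ne_zero C.B_smooth hq

lemma differentiableAt_R {q : ℝ × ℝ} (hq : q ∈ C.D) :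
    DifferentiableAt ℝ (fun q : ℝ × ℝ => C.R q.1 q.2) q :=
  differentiableAt_of_contDiffOn C.isOpen_D two_ne_zero C.R_smooth hq

lemma differentiableAt_dt {F : ℝ → ℝ → ℝ} {q : ℝ × ℝ} (hq : q ∈ C.D)
    (hF : ContDiffOn ℝ 2 (fun q : ℝ × ℝ => F q.1 q.2) C.D) :
    DifferentiableAt ℝ (fun q : ℝ × ℝ => dt F q.1 q.2) q :=
  differentiableAt_of_contDiffOn C.isOpen_D one_ne_zero (contDiffOn_dt C.isOpen_D hF) hq

lemma differentiableAt_dr {F : ℝ → ℝ → ℝ} {q : ℝ × ℝ} (hq : q ∈ C.D)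
    (hF : ContDiffOn ℝ 2 (fun q : ℝ × ℝ => F q.1 q.2) C.D) :
    DifferentiableAt ℝ (fun q : ℝ × ℝ => dr F q.1 q.2) q :=
  differentiableAt_of_contDiffOn C.isOpen_D one_ne_zero (contDiffOn_dr C.isOpen_D hF) hq

lemma differentiableAt_metricRadial {q : ℝ × ℝ} (hq : q ∈ C.D) (a : Fin 4) :
    DifferentiableAt ℝ (fun q : ℝ × ℝ => C.metricRadial a q.1 q.2) q := by
  have hA := C.differentiableAt_A hq
  have hB := C.differentiableAt_B hq
  have hR := C.differentiableAt_R hq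
  fin_cases a <;> simp only [metricRadial] <;> fun_prop

/-- The coordinate derivatives `∂_i g_{aa}`. -/
def metricDeriv (i a : Fin 4) (x : Pt) : ℝ :=
  ![dt (C.metricRadial a) (x 0) (x 1) * metricAngular a (x 2),
    dr (C.metricRadial a) (x 0) (x 1) * metricAngular a (x 2),
    C.metricRadial a (x 0) (x 1) * deriv (metricAngular a) (x 2), 0] i

lemma pd_metric {x : Pt} (hx : (x 0, x 1) ∈ C.D) (i a b : Fin 4) :
    pd i (fun y => C.metric y a b) x = if a = b then C.metricDeriv i a x else 0 := by
  simp only [metric_apply]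
  split_ifs with h
  · have hd := C.differentiableAt_metricRadial hx a
    fin_cases i
    · exact pd_zero_separable hd
    · exact pd_one_separable hd
    · exact pd_two_separable
    · exact pd_three_separable
  · simp [pd]

set_option maxHeartbeats 1000000 in
lemma christoffel_metric {x : Pt} (hx : (x 0, x 1) ∈ C.D) (hs : Real.sin (x 2) ≠ 0)
    (a b c : Fin 4) :
    christoffel C.metric a b c x =
      C.christoffelRadial a b c (x 0) (x 1) * christoffelAngular a b c (x 2) := by
  have hA := C.A_ne hx
  have hB := C.B_ne hx
  have hR := C.R_ne hx
  have hAt := ((hasDerivAt_dt (C.differentiableAt_A hx)).fun_pow 2).deriv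
  have hBt := ((hasDerivAt_dt (C.differentiableAt_B hx)).fun_pow 2).deriv
  have hRt := ((hasDerivAt_dt (C.differentiableAt_R hx)).fun_pow 2).deriv
  have hAr := ((hasDerivAt_dr (C.differentiableAt_A hx)).fun_pow 2).deriv
  have hBr := ((hasDerivAt_dr (C.differentiableAt_B hx)).fun_pow 2).deriv
  have hRr := ((hasDerivAt_dr (C.differentiableAt_R hx)).fun_pow 2).deriv
  have hS := ((Real.hasDerivAt_sin (x 2)).fun_pow 2).deriv
  have hmt : ∀ a, dt (C.metricRadial a) (x 0) (x 1) =
      ![-(2 * C.A (x 0) (x 1) * dt C.A (x 0) (x 1)), 2 * C.B (x 0) (x 1) * dt C.B (x 0) (x 1),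
        2 * C.R (x 0) (x 1) * dt C.R (x 0) (x 1), 2 * C.R (x 0) (x 1) * dt C.R (x 0) (x 1)] a := by
    intro a
    fin_cases a <;> simp_all [dt, metricRadial]
  have hmr : ∀ a, dr (C.metricRadial a) (x 0) (x 1) =
      ![-(2 * C.A (x 0) (x 1) * dr C.A (x 0) (x 1)), 2 * C.B (x 0) (x 1) * dr C.B (x 0) (x 1),
        2 * C.R (x 0) (x 1) * dr C.R (x 0) (x 1), 2 * C.R (x 0) (x 1) * dr C.R (x 0) (x 1)] a := by
    intro a
    fin_cases a <;> simp_all [dr, metricRadial]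
  have hma : ∀ a, deriv (metricAngular a) (x 2) =
      ![0, 0, 0, 2 * Real.sin (x 2) * Real.cos (x 2)] a := by
    intro a
    fin_cases a <;> simp_all [metricAngular]
  simp only [christoffel, C.metric_inv_apply hx hs, C.pd_metric hx, metricDeriv, hmt, hmr, hma,
    ite_mul, zero_mul, Finset.sum_ite_eq, Finset.mem_univ, if_true]
  clear hmt hmr hma hAt hBt hRt hAr hBr hRr hS
  fin_cases a <;> fin_cases b <;> fin_cases c <;>
    simp [metricRadial, metricAngular, christoffelRadial, christoffelAngular] <;> field_simp

lemma differentiableAt_christoffelRadial {q : ℝ × ℝ} (hq : q ∈ C.D) (a b c : Fin 4) :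
    DifferentiableAt ℝ (fun q : ℝ × ℝ => C.christoffelRadial a b c q.1 q.2) q := by
  have hA := C.differentiableAt_A hq
  have hB := C.differentiableAt_B hq
  have hR := C.differentiableAt_R hq
  have hAt := C.differentiableAt_dt hq C.A_smooth
  have hBt := C.differentiableAt_dt hq C.B_smooth
  have hRt := C.differentiableAt_dt hq C.R_smooth
  have hAr := C.differentiableAt_dr hq C.A_smooth
  have hBr := C.differentiableAt_dr hq C.B_smooth
  have hRr := C.differentiableAt_dr hq C.R_smooth
  have hA0 := C.A_ne hq
  have hB0 := C.B_ne hq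
  have hR0 := C.R_ne hq
  have hA2 := pow_ne_zero 2 hA0
  have hB2 := pow_ne_zero 2 hB0
  unfold christoffelRadial
  split <;> fun_prop (disch := assumption)

/-- The coordinate derivatives `∂_i Γ^a_{bc}`. -/
def christoffelDeriv (i a b c : Fin 4) (x : Pt) : ℝ :=
  ![dt (C.christoffelRadial a b c) (x 0) (x 1) * christoffelAngular a b c (x 2),
    dr (C.christoffelRadial a b c) (x 0) (x 1) * christoffelAngular a b c (x 2),
    C.christoffelRadial a b c (x 0) (x 1) * deriv (christoffelAngular a b c) (x 2), 0] i

/-- The closed form of the symbols holds on a whole neighbourhood, since `D` is open and `sin θ ≠ 0`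
is an open condition; it may therefore be differentiated. -/
lemma pd_christoffel {x : Pt} (hx : (x 0, x 1) ∈ C.D) (hs : Real.sin (x 2) ≠ 0)
    (i a b c : Fin 4) :
    pd i (christoffel C.metric a b c) x = C.christoffelDeriv i a b c x := by
  have hD : ∀ᶠ y : Pt in 𝓝 x, (y 0, y 1) ∈ C.D := by
    have hc : Continuous fun y : Pt => (y 0, y 1) := by fun_prop
    exact hc.continuousAt.eventually (C.isOpen_D.mem_nhds hx)
  have hS : ∀ᶠ y : Pt in 𝓝 x, Real.sin (y 2) ≠ 0 := by
    have hc : Continuous fun y : Pt => Real.sin (y 2) := by fun_prop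
    exact hc.continuousAt.eventually_ne hs
  have he : christoffel C.metric a b c =ᶠ[𝓝 x]
      fun y => C.christoffelRadial a b c (y 0) (y 1) * christoffelAngular a b c (y 2) := by
    filter_upwards [hD, hS] with y h1 h2 using C.christoffel_metric h1 h2 a b c
  have hd := C.differentiableAt_christoffelRadial hx a b c
  rw [pd_congr i he]
  fin_cases i
  · exact pd_zero_separable hd
  · exact pd_one_separable hd
  · exact pd_two_separable
  · exact pd_three_separable

end Cloud

/-! ### Partial derivatives of the quotients in the Christoffel symbols -/

section PartialQuotientRules

variable {F G H : ℝ → ℝ → ℝ} {q : ℝ × ℝ}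

lemma dt_quotient (hF : DifferentiableAt ℝ (fun q : ℝ × ℝ => F q.1 q.2) q)
    (hG : DifferentiableAt ℝ (fun q : ℝ × ℝ => G q.1 q.2) q) (h0 : G q.1 q.2 ≠ 0) :
    dt (fun t r => F t r / G t r) q.1 q.2 =
      dt F q.1 q.2 / G q.1 q.2 - F q.1 q.2 * dt G q.1 q.2 / G q.1 q.2 ^ 2 :=
  (hasDerivAt_quotient (hasDerivAt_dt hF) (hasDerivAt_dt hG) h0).deriv

lemma dr_quotient (hF : DifferentiableAt ℝ (fun q : ℝ × ℝ => F q.1 q.2) q)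
    (hG : DifferentiableAt ℝ (fun q : ℝ × ℝ => G q.1 q.2) q) (h0 : G q.1 q.2 ≠ 0) :
    dr (fun t r => F t r / G t r) q.1 q.2 =
      dr F q.1 q.2 / G q.1 q.2 - F q.1 q.2 * dr G q.1 q.2 / G q.1 q.2 ^ 2 :=
  (hasDerivAt_quotient (hasDerivAt_dr hF) (hasDerivAt_dr hG) h0).deriv

lemma dt_mul_div_sq (hF : DifferentiableAt ℝ (fun q : ℝ × ℝ => F q.1 q.2) q)
    (hG : DifferentiableAt ℝ (fun q : ℝ × ℝ => G q.1 q.2) q)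
    (hH : DifferentiableAt ℝ (fun q : ℝ × ℝ => H q.1 q.2) q) (h0 : H q.1 q.2 ≠ 0) :
    dt (fun t r => F t r * G t r / H t r ^ 2) q.1 q.2 =
      (dt F q.1 q.2 * G q.1 q.2 + F q.1 q.2 * dt G q.1 q.2) / H q.1 q.2 ^ 2
        - 2 * F q.1 q.2 * G q.1 q.2 * dt H q.1 q.2 / H q.1 q.2 ^ 3 :=
  (hasDerivAt_mul_div_sq (hasDerivAt_dt hF) (hasDerivAt_dt hG) (hasDerivAt_dt hH) h0).deriv

lemma dr_mul_div_sq (hF : DifferentiableAt ℝ (fun q : ℝ × ℝ => F q.1 q.2) q)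
    (hG : DifferentiableAt ℝ (fun q : ℝ × ℝ => G q.1 q.2) q)
    (hH : DifferentiableAt ℝ (fun q : ℝ × ℝ => H q.1 q.2) q) (h0 : H q.1 q.2 ≠ 0) :
    dr (fun t r => F t r * G t r / H t r ^ 2) q.1 q.2 =
      (dr F q.1 q.2 * G q.1 q.2 + F q.1 q.2 * dr G q.1 q.2) / H q.1 q.2 ^ 2
        - 2 * F q.1 q.2 * G q.1 q.2 * dr H q.1 q.2 / H q.1 q.2 ^ 3 :=
  (hasDerivAt_mul_div_sq (hasDerivAt_dr hF) (hasDerivAt_dr hG) (hasDerivAt_dr hH) h0).deriv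

lemma dt_const (c : ℝ) (t r : ℝ) : dt (fun _ _ => c) t r = 0 := by simp [dt]

lemma dr_const (c : ℝ) (t r : ℝ) : dr (fun _ _ => c) t r = 0 := by simp [dr]

end PartialQuotientRules

namespace Cloud

variable (C : Cloud)

/-! ### Curvature on the 2-sheets -/

/-- The sectional curvature component `R^{tr}_{tr}`. -/
def curvTR (t r : ℝ) : ℝ :=
  -dr (dr C.A) t r / (C.A t r * C.B t r ^ 2) + dr C.A t r * dr C.B t r / (C.A t r * C.B t r ^ 3)
    + dt (dt C.B) t r / (C.B t r * C.A t r ^ 2) - dt C.A t r * dt C.B t r / (C.A t r ^ 3 * C.B t r)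

/-- The sectional curvature component `R^{tθ}_{tθ}`. -/
def curvTS (t r : ℝ) : ℝ :=
  dt (dt C.R) t r / (C.R t r * C.A t r ^ 2) - dt C.R t r * dt C.A t r / (C.R t r * C.A t r ^ 3)
    - dr C.R t r * dr C.A t r / (C.R t r * C.A t r * C.B t r ^ 2)

/-- The sectional curvature component `R^{rθ}_{rθ}`. -/
def curvRS (t r : ℝ) : ℝ :=
  -dr (dr C.R) t r / (C.R t r * C.B t r ^ 2) + dt C.R t r * dt C.B t r /
    (C.R t r * C.A t r ^ 2 * C.B t r) + dr C.R t r * dr C.B t r / (C.R t r * C.B t r ^ 3)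

/-- The sectional curvature component `R^{θϕ}_{θϕ}`; this is `2 m / R ^ 3` for the Misner-Sharp
mass `m`. -/
def curvSS (t r : ℝ) : ℝ :=
  (1 + dt C.R t r ^ 2 / C.A t r ^ 2 - dr C.R t r ^ 2 / C.B t r ^ 2) / C.R t r ^ 2

/-- The mixed component `R^θ_{tθr}`. -/
def curvMixed (t r : ℝ) : ℝ :=
  (-dr (dt C.R) t r + dt C.R t r * dr C.A t r / C.A t r + dr C.R t r * dt C.B t r / C.B t r) /
    C.R t r

lemma christoffelDeriv_sheetPt (q : ℝ × ℝ) (i a b c : Fin 4) :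
    C.christoffelDeriv i a b c (sheetPt q) =
      ![dt (C.christoffelRadial a b c) q.1 q.2 * christoffelAngular a b c (Real.pi / 2),
        dr (C.christoffelRadial a b c) q.1 q.2 * christoffelAngular a b c (Real.pi / 2),
        C.christoffelRadial a b c q.1 q.2 * deriv (christoffelAngular a b c) (Real.pi / 2), 0] i :=
  rfl

lemma riemann_sheetPt {q : ℝ × ℝ} (hq : q ∈ C.D) (a b c d : Fin 4) :
    riemann C.metric a b c d (sheetPt q) =
      C.christoffelDeriv c a d b (sheetPt q) - C.christoffelDeriv d a c b (sheetPt q)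
        + ∑ e, (C.christoffelRadial a c e q.1 q.2 * christoffelAngular a c e (Real.pi / 2) *
            (C.christoffelRadial e d b q.1 q.2 * christoffelAngular e d b (Real.pi / 2))
          - C.christoffelRadial a d e q.1 q.2 * christoffelAngular a d e (Real.pi / 2) *
            (C.christoffelRadial e c b q.1 q.2 * christoffelAngular e c b (Real.pi / 2))) := by
  have hx : (sheetPt q 0, sheetPt q 1) ∈ C.D := hq
  have hs : Real.sin (sheetPt q 2) ≠ 0 := by simp [sheetPt]
  simp only [riemann, C.pd_christoffel hx hs, C.christoffel_metric hx hs]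
  rfl

/-- On the equator `cos θ` vanishes but the derivatives of `-sin θ cos θ` and `cot θ` do not. These
supply the curvature of the unit sphere, the summand `1` in `curvSS`. -/
lemma deriv_christoffelAngular (a b c : Fin 4) :
    deriv (christoffelAngular a b c) (Real.pi / 2) =
      if a = 2 ∧ b = 3 ∧ c = 3 then 1 else
        if a = 3 ∧ (b = 2 ∧ c = 3 ∨ b = 3 ∧ c = 2) then -1 else 0 := by
  have h1 := (Real.hasDerivAt_sin (Real.pi / 2)).fun_pow 2
  have h2 := ((Real.hasDerivAt_sin (Real.pi / 2)).fun_mul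
    (Real.hasDerivAt_cos (Real.pi / 2))).fun_neg.deriv
  have h3 := ((Real.hasDerivAt_cos (Real.pi / 2)).fun_div
    (Real.hasDerivAt_sin (Real.pi / 2)) (by simp)).deriv
  have h4 := h1.fun_neg.deriv
  have h5 := h1.deriv
  simp at h2 h3 h4 h5
  unfold christoffelAngular
  split <;> first | (simp_all; done) | (rw [deriv_const]; grind)

set_option maxHeartbeats 2000000 in
/-- The Riemann component `R^r_{trt}`, the diagonal of the Ricci tensor and its `tr` component, in
terms of the sectional curvatures. -/
lemma ricci_sheetPt {q : ℝ × ℝ} (hq : q ∈ C.D) :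
    riemann C.metric 1 0 1 0 (sheetPt q) = -C.A q.1 q.2 ^ 2 * C.curvTR q.1 q.2 ∧
    ricci C.metric 0 0 (sheetPt q) =
      -C.A q.1 q.2 ^ 2 * (C.curvTR q.1 q.2 + 2 * C.curvTS q.1 q.2) ∧
    ricci C.metric 1 1 (sheetPt q) =
      C.B q.1 q.2 ^ 2 * (C.curvTR q.1 q.2 + 2 * C.curvRS q.1 q.2) ∧
    ricci C.metric 2 2 (sheetPt q) =
      C.R q.1 q.2 ^ 2 * (C.curvTS q.1 q.2 + C.curvRS q.1 q.2 + C.curvSS q.1 q.2) ∧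
    ricci C.metric 3 3 (sheetPt q) =
      C.R q.1 q.2 ^ 2 * (C.curvTS q.1 q.2 + C.curvRS q.1 q.2 + C.curvSS q.1 q.2) ∧
    ricci C.metric 0 1 (sheetPt q) = 2 * C.curvMixed q.1 q.2 := by
  have hA := C.A_ne hq
  have hB := C.B_ne hq
  have hR := C.R_ne hq
  have dA := C.differentiableAt_A hq
  have dB := C.differentiableAt_B hq
  have dR := C.differentiableAt_R hq
  have dAt := C.differentiableAt_dt hq C.A_smooth
  have dBt := C.differentiableAt_dt hq C.B_smooth
  have dRt := C.differentiableAt_dt hq C.R_smooth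
  have dAr := C.differentiableAt_dr hq C.A_smooth
  have dBr := C.differentiableAt_dr hq C.B_smooth
  have dRr := C.differentiableAt_dr hq C.R_smooth
  -- In the `tr` Ricci component, `∂_t(A_r/A) - ∂_r(A_t/A)` has to cancel.
  have sA := dt_dr_comm C.isOpen_D C.A_smooth hq
  have sB := dt_dr_comm C.isOpen_D C.B_smooth hq
  have t1 := dt_quotient dAr dA hA
  have t2 := dt_quotient dBt dB hB
  have t3 := dt_quotient dBr dB hB
  have t4 := dt_quotient dRt dR hR
  have t5 := dt_quotient dRr dR hR
  have r1 := dr_quotient dAt dA hA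
  have r2 := dr_quotient dAr dA hA
  have r3 := dr_quotient dBt dB hB
  have r4 := dr_quotient dRt dR hR
  have r5 := dr_quotient dRr dR hR
  have t6 := dt_mul_div_sq dB dBt dA hA
  have t7 := dt_mul_div_sq dR dRt dA hA
  have r6 := dr_mul_div_sq dA dAr dB hB
  have r7 := dr_mul_div_sq dR dRr dB hB
  refine ⟨?_, ?_, ?_, ?_, ?_, ?_⟩ <;>
  simp only [ricci, C.riemann_sheetPt hq, christoffelDeriv_sheetPt, Fin.sum_univ_four] <;>
  simp [christoffelRadial, christoffelAngular, deriv_christoffelAngular, dt_const, dr_const,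
    t1, t2, t3, t4, t5, t6, t7, r1, r2, r3, r4, r5, r6, r7, sA, sB,
    curvTR, curvTS, curvRS, curvSS, curvMixed] <;>
  field_simp <;> ring

lemma metric_sheetPt (q : ℝ × ℝ) (a b : Fin 4) :
    C.metric (sheetPt q) a b =
      if a = b then
        ![-C.A q.1 q.2 ^ 2, C.B q.1 q.2 ^ 2, C.R q.1 q.2 ^ 2, C.R q.1 q.2 ^ 2] a else 0 := by
  rw [metric_apply]
  fin_cases a <;> simp [metricRadial, metricAngular, sheetPt]

lemma metric_inv_sheetPt {q : ℝ × ℝ} (hq : q ∈ C.D) (a b : Fin 4) :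
    (C.metric (sheetPt q))⁻¹ a b =
      if a = b then
        ![-(1 / C.A q.1 q.2 ^ 2), 1 / C.B q.1 q.2 ^ 2, 1 / C.R q.1 q.2 ^ 2,
          1 / C.R q.1 q.2 ^ 2] a else 0 := by
  have hx : (sheetPt q 0, sheetPt q 1) ∈ C.D := hq
  rw [C.metric_inv_apply hx (by simp [sheetPt])]
  fin_cases a <;> simp [metricRadial, metricAngular, sheetPt]

lemma scalarCurvature_sheetPt {q : ℝ × ℝ} (hq : q ∈ C.D) :
    scalarCurvature C.metric (sheetPt q) =
      2 * C.curvTR q.1 q.2 + 4 * C.curvTS q.1 q.2 + 4 * C.curvRS q.1 q.2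
        + 2 * C.curvSS q.1 q.2 := by
  obtain ⟨-, h0, h1, h2, h3, -⟩ := C.ricci_sheetPt hq
  have hA := C.A_ne hq
  have hB := C.B_ne hq
  have hR := C.R_ne hq
  simp only [scalarCurvature, C.metric_inv_sheetPt hq, ite_mul, zero_mul, Finset.sum_ite_eq,
    Finset.mem_univ, if_true]
  simp [Fin.sum_univ_four, h0, h1, h2, h3]
  field_simp
  ring

/-- Einstein's equations for the perfect fluid, in terms of the sectional curvatures. -/
lemma SolvesEinstein.curvature_eqs (hE : C.SolvesEinstein) {q : ℝ × ℝ} (hq : q ∈ C.D) :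
    2 * C.curvRS q.1 q.2 + C.curvSS q.1 q.2 = C.mu q.1 q.2 ∧
    C.curvMixed q.1 q.2 = 0 ∧
    -(2 * C.curvTS q.1 q.2 + C.curvSS q.1 q.2) = C.p q.1 q.2 ∧
    -(C.curvTR q.1 q.2 + C.curvTS q.1 q.2 + C.curvRS q.1 q.2) = C.p q.1 q.2 := by
  obtain ⟨-, h0, h1, h2, -, h01⟩ := C.ricci_sheetPt hq
  have hA := C.A_ne hq
  have hB := C.B_ne hq
  have hR := C.R_ne hq
  have hx : (sheetPt q 0, sheetPt q 1) ∈ C.D := hq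
  have hs : sheetPt q 2 ∈ Ioo 0 Real.pi := by
    constructor <;> simp [sheetPt] <;> linarith [Real.pi_pos]
  have hl : ∀ a, lower C.metric C.u a (sheetPt q) = ![-C.A q.1 q.2, 0, 0, 0] a := by
    intro a
    simp only [lower, C.metric_sheetPt, ite_mul, zero_mul, Finset.sum_ite_eq, Finset.mem_univ,
      if_true]
    fin_cases a <;> simp [u, sheetPt]
    field_simp
  -- The `tt`, `rr`, `θθ` and `tr` equations give `μ`, `p`, `p` again, and the vanishing mixed
  -- curvature.
  have e := hE (sheetPt q) hx hs
  have e0 := e 0 0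
  have e1 := e 1 1
  have e2 := e 2 2
  have e3 := e 0 1
  simp only [einstein, C.scalarCurvature_sheetPt hq, hl, C.metric_sheetPt, h0, h1, h2, h01]
    at e0 e1 e2 e3
  simp [sheetPt] at e0 e1 e2 e3
  refine ⟨?_, e3, ?_, ?_⟩
  · apply mul_left_cancel₀ (pow_ne_zero 2 hA)
    linear_combination e0
  · apply mul_left_cancel₀ (pow_ne_zero 2 hB)
    linear_combination e1
  · apply mul_left_cancel₀ (pow_ne_zero 2 hR)
    linear_combination e2

/-- The trace-free part of the curvature gives `3ℰ = curvTS + curvRS - curvTR - curvSS`. The energy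
density and the two expressions for the pressure eliminate all but `curvSS`. -/
lemma weylE_eq (hE : C.SolvesEinstein) {q : ℝ × ℝ} (hq : q ∈ C.D) :
    C.weylE q = C.mu q.1 q.2 / 3 - C.curvSS q.1 q.2 := by
  obtain ⟨h, h0, h1, -, -, -⟩ := C.ricci_sheetPt hq
  obtain ⟨k0, -, k1, k2⟩ := SolvesEinstein.curvature_eqs C hE hq
  have hA := C.A_ne hq
  have hB := C.B_ne hq
  have hw : weyl C.metric 1 0 1 0 (sheetPt q) =
      C.A q.1 q.2 ^ 2 * C.B q.1 q.2 ^ 2 * (C.mu q.1 q.2 / 3 - C.curvSS q.1 q.2) := by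
    simp only [weyl, riemannLow, C.scalarCurvature_sheetPt hq, C.metric_sheetPt, ite_mul, zero_mul,
      Finset.sum_ite_eq, Finset.mem_univ, if_true, h, h0, h1]
    simp
    linear_combination C.A q.1 q.2 ^ 2 * C.B q.1 q.2 ^ 2 * (1 / 3 * k2 - 1 / 3 * k1 + 1 / 3 * k0)
  have he : C.weylE q = weyl C.metric 1 0 1 0 (sheetPt q) *
      (1 / C.B q.1 q.2) * (1 / C.A q.1 q.2) * (1 / C.B q.1 q.2) * (1 / C.A q.1 q.2) := by
    simp [weylE, electricWeyl, Fin.sum_univ_four, u, e, sheetPt]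
  rw [he, hw]
  field_simp

/-! ### The apparent horizon and its slope -/

/-- The areal expansion `u(R) + e(R)` along the outgoing null direction. -/
def outRate (t r : ℝ) : ℝ := dt C.R t r / C.A t r + dr C.R t r / C.B t r

/-- The null field has no angular components, so only the terms `-Γ^c_{θθ} k_c` and `-Γ^c_{ϕϕ} k_c`
with `c = t, r` survive, and these are derivatives of `R`. -/
lemma thetaOut_eq {q : ℝ × ℝ} (hq : q ∈ C.D) :
    C.thetaOut q = √2 / C.R q.1 q.2 * C.outRate q.1 q.2 := by
  have hA := C.A_ne hq
  have hB := C.B_ne hq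
  have hR := C.R_ne hq
  have h2 : √2 ≠ 0 := by positivity
  have hl : ∀ x a, lower C.metric C.outNull a x =
      C.metricRadial a (x 0) (x 1) * metricAngular a (x 2) * C.outNull x a := by
    intro x a
    simp only [lower, C.metric_apply, ite_mul, zero_mul, Finset.sum_ite_eq, Finset.mem_univ,
      if_true]
  have hp : ∀ i a, a = 2 ∨ a = 3 → pd i (lower C.metric C.outNull a) (sheetPt q) = 0 := by
    intro i a ha
    have : lower C.metric C.outNull a = fun _ => 0 := by
      ext x
      rw [hl]
      rcases ha with rfl | rfl <;> simp [outNull, u, e]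
    simp [this, pd]
  have hx : (sheetPt q 0, sheetPt q 1) ∈ C.D := hq
  have hs : Real.sin (sheetPt q 2) ≠ 0 := by simp [sheetPt]
  have hn : C.thetaOut q = 1 / C.R q.1 q.2 ^ 2 *
      (nabla C.metric C.outNull 2 2 (sheetPt q) + nabla C.metric C.outNull 3 3 (sheetPt q)) := by
    simp only [thetaOut, sheetExpansion, C.metric_inv_sheetPt hq, Fin.sum_univ_four]
    simp [u, e, sheetPt]
    field_simp
    ring
  rw [hn]
  simp only [nabla, hp 2 2 (.inl rfl), hp 3 3 (.inr rfl), C.christoffel_metric hx hs, hl,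
    Fin.sum_univ_four]
  simp [christoffelRadial, christoffelAngular, metricRadial, metricAngular, outNull, u, e, sheetPt,
    outRate]
  field_simp
  rw [Real.sq_sqrt zero_le_two]
  ring

/-- The slope of the apparent horizon. -/
lemma horizon_slope (hE : C.SolvesEinstein) {γ : ℝ → ℝ × ℝ} {α β s : ℝ} (hq : γ s ∈ C.D)
    (hγ : HasDerivAt γ (α / C.A (γ s).1 (γ s).2, β / C.B (γ s).1 (γ s).2) s)
    (h0 : ∀ᶠ s' in 𝓝 s, C.outRate (γ s').1 (γ s').2 = 0) :
    α * (1 + C.p (γ s).1 (γ s).2 * C.R (γ s).1 (γ s).2 ^ 2) =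
      β * (1 - C.mu (γ s).1 (γ s).2 * C.R (γ s).1 (γ s).2 ^ 2) := by
  obtain ⟨k0, k01, k1, -⟩ := SolvesEinstein.curvature_eqs C hE hq
  have hA := C.A_ne hq
  have hB := C.B_ne hq
  have hR := C.R_ne hq
  have dA := hasDerivAt_comp_curve (C.differentiableAt_A hq) hγ
  have dB := hasDerivAt_comp_curve (C.differentiableAt_B hq) hγ
  have dRt := hasDerivAt_comp_curve (C.differentiableAt_dt hq C.R_smooth) hγ
  have dRr := hasDerivAt_comp_curve (C.differentiableAt_dr hq C.R_smooth) hγ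
  have sR := dt_dr_comm C.isOpen_D C.R_smooth hq
  have hd := (hasDerivAt_quotient dRt dA hA).fun_add (hasDerivAt_quotient dRr dB hB)
  have hz : HasDerivAt (fun s => dt C.R (γ s).1 (γ s).2 / C.A (γ s).1 (γ s).2
      + dr C.R (γ s).1 (γ s).2 / C.B (γ s).1 (γ s).2) 0 s :=
    (hasDerivAt_const s (0 : ℝ)).congr_of_eventuallyEq h0
  -- The expansion vanishes identically along the curve near `s`, so its chain-rule derivative is
  -- zero.
  have hu := hd.unique hz
  have hs := h0.self_of_nhds
  rw [sR] at hu
  simp only [outRate] at hs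
  simp only [curvRS, curvSS, curvTS, curvMixed] at k0 k01 k1
  rw [← k0, ← k1]
  generalize C.A (γ s).1 (γ s).2 = A at *
  generalize C.B (γ s).1 (γ s).2 = B at *
  generalize C.R (γ s).1 (γ s).2 = R at *
  generalize dt (dt C.R) (γ s).1 (γ s).2 = Rtt at *
  generalize dr (dt C.R) (γ s).1 (γ s).2 = Rtr at *
  generalize dr (dr C.R) (γ s).1 (γ s).2 = Rrr at *
  generalize dt C.R (γ s).1 (γ s).2 = Rt at *
  generalize dr C.R (γ s).1 (γ s).2 = Rr at *
  generalize dt C.A (γ s).1 (γ s).2 = At at *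
  generalize dr C.A (γ s).1 (γ s).2 = Ar at *
  generalize dt C.B (γ s).1 (γ s).2 = Bt at *
  generalize dr C.B (γ s).1 (γ s).2 = Br at *
  -- The horizon condition eliminates `R_r`, and the `tr` field equation eliminates `R_{tr}`.
  have e1 : Rr = -(B * Rt / A) := by
    field_simp at hs ⊢
    linear_combination hs
  have e2 : Rtr = Rt * Ar / A + Rr * Bt / B := by
    rw [div_eq_zero_iff, or_iff_left hR] at k01
    linear_combination -k01
  subst e2 e1
  -- After elimination the `u`-derivative of the expansion is `-(1 + pR²)/(2R)` and its
  -- `e`-derivative is `(1 - μR²)/(2R)`, which explains the factor `-2R`.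
  linear_combination (norm := skip) (-2 * R) * hu
  field_simp
  ring

end Cloud
end SphericalCollapse
end

/-! ### Estimates from the energy conditions -/

namespace SphericalCollapse

/-- If `x = μ R²` and `y = p R²` obey the strong energy condition and the horizon slope
`(1 - x) / (1 + y)` is close to `1`, then `x` and `y` are small. -/
lemma density_small_of_slope {x y w ε : ℝ} (hx : 0 ≤ x) (hxy : 0 ≤ x + 3 * y) (hε : 0 < ε)
    (hε' : ε ≤ 1 / 2) (hw : |w - 1| < ε) (h : w * (1 + y) = 1 - x) :
    x ≤ 3 * ε ∧ x + y ≤ 3 * ε := by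
  obtain ⟨h1, h2⟩ := abs_lt.mp hw
  -- If `y ≤ -1`, then `1 - x ≤ 1 + 3y`, while `w ≤ 3/2` gives `w(1 + y) ≥ 3(1 + y)/2`; together
  -- these force `y > 0`.
  have hy : 0 < 1 + y := by
    by_contra! hy
    nlinarith [mul_nonneg (neg_nonneg.mpr hy) (by linarith : 0 ≤ 3 / 2 - w)]
  have h3 : x + y ≤ ε * (1 + y) := by nlinarith
  -- For `y ≥ 0`, `ε ≤ 1/2` absorbs `εy` into the left side. For `y ≤ 0`, the energy condition gives
  -- `x + y ≥ 2x/3`.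
  rcases le_total 0 y with h0 | h0
  · constructor <;> nlinarith
  · constructor <;> nlinarith

/-- Since `x ≤ 3/2`, the numerator is at least `1/2`, while the denominator is at most `3ε`. -/
lemma le_weyl_ratio {x y ε : ℝ} (hx : 0 ≤ x) (h0 : 0 < x + y) (hε : 0 < ε) (hε' : ε ≤ 1 / 2)
    (h1 : x ≤ 3 * ε) (h2 : x + y ≤ 3 * ε) : 1 / (6 * ε) ≤ |x / 3 - 1| / (x + y) := by
  rw [abs_of_nonpos (by linarith), div_le_div_iff₀ (by positivity) h0]
  nlinarith

end SphericalCollapse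

theorem proposition4 (C : SphericalCollapse.Cloud)
    (hEinstein : C.SolvesEinstein)
    (hEnergy : C.StrongEnergy)
    (hShell : C.NoShellCrossing)
    (hTrapped : C.HasTrappedSurface)
    (ts : ℝ) (hSing : C.IsCentralSingularity ts)
    (γ : ℝ → ℝ × ℝ) (α β : ℝ → ℝ) (hHorizon : C.IsHorizonCurve ts γ α β)
    (hNaked : SphericalCollapse.MarginallyNaked α β)
    (hFluid : ∀ᶠ s in 𝓝[>] (0 : ℝ),
      C.mu (γ s).1 (γ s).2 + C.p (γ s).1 (γ s).2 ≠ 0) :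
    Tendsto (fun s => |C.weylE (γ s)| / (C.mu (γ s).1 (γ s).2 + C.p (γ s).1 (γ s).2))
      (𝓝[>] 0) atTop := by
  have hrate : ∀ᶠ s in 𝓝[>] (0 : ℝ), C.outRate (γ s).1 (γ s).2 = 0 := by
    filter_upwards [hHorizon.mem, hHorizon.horizon] with s hm hh
    rw [C.thetaOut_eq hm] at hh
    have hR := C.R_pos _ hm
    exact (mul_eq_zero.mp hh).resolve_left (by positivity)
  -- Differentiation along the curve needs vanishing on a two-sided neighbourhood of each `s > 0`.
  have hnear : ∀ᶠ s in 𝓝[>] (0 : ℝ), ∀ᶠ s' in 𝓝 s, C.outRate (γ s').1 (γ s').2 = 0 := by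
    filter_upwards [eventually_eventually_nhdsWithin.mpr hrate, self_mem_nhdsWithin] with s h1 h2
    rwa [(isOpen_Ioi : IsOpen (Ioi (0 : ℝ))).nhdsWithin_eq h2] at h1
  rw [tendsto_atTop]
  intro M
  obtain ⟨ε, hε, hε', hM⟩ : ∃ ε : ℝ, 0 < ε ∧ ε ≤ 1 / 2 ∧ M ≤ 1 / (6 * ε) := by
    -- With this choice `1/(6ε) = |M| + 1`.
    refine ⟨1 / (6 * (|M| + 1)), by positivity, ?_, ?_⟩
    · rw [div_le_div_iff₀ (by positivity) two_pos]
      linarith [abs_nonneg M]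
    · field_simp
      linarith [le_abs_self M]
  filter_upwards [hHorizon.mem, hrate, hnear, hHorizon.tangent, hFluid,
    Metric.tendsto_nhds.mp hNaked ε hε] with s hm h0 hn ht hf hd
  rw [Real.dist_eq] at hd
  have hR := C.R_pos _ hm
  have hA := C.A_ne hm
  have hB := C.B_ne hm
  obtain ⟨hmu, hmp⟩ := hEnergy _ hm
  have hslope := C.horizon_slope hEinstein hm ht hn
  -- On the horizon `u(R) = -e(R)`, so the squares in `curvSS` cancel.
  have hcurv : C.curvSS (γ s).1 (γ s).2 = 1 / C.R (γ s).1 (γ s).2 ^ 2 := by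
    simp only [SphericalCollapse.Cloud.outRate] at h0
    rw [SphericalCollapse.Cloud.curvSS, ← div_pow, ← div_pow, eq_neg_of_add_eq_zero_left h0]
    ring
  rw [C.weylE_eq hEinstein hm, hcurv]
  generalize C.mu (γ s).1 (γ s).2 = m at *
  generalize C.p (γ s).1 (γ s).2 = p at *
  generalize C.R (γ s).1 (γ s).2 = R at *
  have hR2 : 0 < R ^ 2 := by positivity
  -- If `β s = 0`, the quotient `α s / β s` is `0` by convention, at distance `1 > ε` from `1`.
  have hβ : β s ≠ 0 := by
    intro h
    rw [h, div_zero] at hd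
    norm_num at hd
    linarith
  have hw : α s / β s * (1 + p * R ^ 2) = 1 - m * R ^ 2 := by
    field_simp
    linear_combination hslope
  have hx : 0 ≤ m * R ^ 2 := by positivity
  have hxy : 0 ≤ m * R ^ 2 + 3 * (p * R ^ 2) := by nlinarith
  -- Here `3(m + p) = 2m + (m + 3p) ≥ 0`, and the non-vacuum assumption makes it strict.
  have hpos : 0 < m + p := lt_of_le_of_ne (by linarith) hf.symm
  obtain ⟨h1, h2⟩ := SphericalCollapse.density_small_of_slope hx hxy hε hε' hd hw
  refine hM.trans ((SphericalCollapse.le_weyl_ratio hx (by nlinarith) hε hε' h1 h2).trans_eq ?_)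
  have e : m / 3 - 1 / R ^ 2 = (m * R ^ 2 / 3 - 1) / R ^ 2 := by field_simp
  rw [e, abs_div, abs_of_pos hR2, ← add_mul]
  field_simp
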